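/- Let $q$ be a prime power. The Heisenberg group $\mathbb H_1(\mathbb F_q)$ is $\mathbb F_q^3$ with the group law $(x,y,t)\cdot(x',y',t')=(x+x',\,y+y',\,t+t'+xy'-yx')$. For $p=(x_0,y_0,t_0)\in\mathbb H_1(\mathbb F_q)$ and $(a,b)\in\mathbb F_q^2\setminus\{(0,0)\}$, the set $L=\{p\cdot(sa,sb,0):s\in\mathbb F_q\}$ is called a horizontal line, and its refined direction is $\mathrm{Dir}(L)=[a:b:x_0b-y_0a]$, an element of $\mathcal D_1=\{[a:b:c]\in\mathbb P^2(\mathbb F_q):(a,b)\ne(0,0)\}$; it depends only on $L$. For $f:\mathbb H_1(\mathbb F_q)\to\mathbb C$ and $\omega\in\mathcal D_1$ put $$\mathcal M^{\mathrm{rd}}f(\omega)=\max_{L\ \text{horizontal},\ \mathrm{Dir}(L)=\omega}\ \sum_{p\in L}|f(p)| .$$ For $1\le u,v\le\infty$ let $A_1^{\mathrm{rd}}(u,v)$ be the infimum of all real numbers $\alpha\ge0$ (the smallest such exponent) for which there is a constant $C>0$ with $$\|\mathcal M^{\mathrm{rd}}f\|_{\ell^v(\mathcal D_1)}\le C\,q^{\alpha}\,\|f\|_{\ell^u(\mathbb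 H_1(\mathbb F_q))}$$ for all prime powers $q$ and all $f:\mathbb H_1(\mathbb F_q)\to\mathbb C$, where the norms are taken with respect to counting measure. **Theorem.** (i) For all $1\le u,v\le\infty$ there is a constant $c=c(u,v)>0$ such that the following holds for every prime power $q$. Let $\Omega\subset\mathcal D_1$, let $E\subset\mathbb H_1(\mathbb F_q)$, and let $m$ be an integer with $1\le m\le q$. If $v=\infty$, suppose that $\Omega\neq\emptyset$. Assume that for every $\omega\in\Omega$ there is a horizontal line $L$ with $\mathrm{Dir}(L)=\omega$ and $|E\cap L|\ge m$. If $u<\infty$, then $$|E|\ \ge\ c\,m^{u}\,|\Omega|^{u/v}\,q^{-u\,A_1^{\mathrm{rd}}(u,v)},$$ and if $u=\infty$, the bound holds in the form obtained by taking $u$-th roots, $$1\ \ge\ c\,m\,|\Omega|^{1/v}\,q^{-A_1^{\mathrm{rd}}(\infty,v)}.$$ Here $u/v=1/v=0$ and $|\Omega|^{0}=1$ when $v=\infty$. (ii) There is an absolute constant $c>0$ such that for every prime power $q$ and all $\Omega,E,m$ satisfying the assumptions of (i) (with $\Omega$ allowed to be empty), $$|E|\ \ge\ c\,\frac{m^2|\Omega|}{q}.$$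 (iii) There is an absolute constant $c>0$ such that for every prime power $q$, every set $E\subset\mathbb H_1(\mathbb F_q)$ that contains, for each $\omega\in\mathcal D_1$, a horizontal line $L$ with $\mathrm{Dir}(L)=\omega$ (a full-direction horizontal Heisenberg Kakeya set) satisfies $|E|\ge c\,q^3$. -/

import Mathlib

open scoped ENNReal LinearAlgebra.Projectivization

/-- The first Heisenberg group `ℍ₁(F)`: the set `F × F × F` with the twisted group law below. -/
@[ext]
structure Heis (F : Type*) where
  x : F
  y : F
  t : F

namespace Heis

section Basic

variable {F : Type*}

/-- The identification of the underlying set of `ℍ₁(F)` with `F × F × F`. -/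
def equivProd : Heis F ≃ F × F × F where
  toFun p := (p.x, p.y, p.t)
  invFun p := ⟨p.1, p.2.1, p.2.2⟩
  left_inv _ := rfl
  right_inv _ := rfl

noncomputable instance [Fintype F] : Fintype (Heis F) := Fintype.ofEquiv _ equivProd.symm

variable [Field F]

/-- `(x, y, t) · (x', y', t') = (x + x', y + y', t + t' + (x y' - y x'))`. -/
instance : Mul (Heis F) :=
  ⟨fun p r => ⟨p.x + r.x, p.y + r.y, p.t + r.t + (p.x * r.y - p.y * r.x)⟩⟩

instance : One (Heis F) := ⟨⟨0, 0, 0⟩⟩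

instance : Inv (Heis F) := ⟨fun p => ⟨-p.x, -p.y, -p.t⟩⟩

@[simp] theorem mul_x (p r : Heis F) : (p * r).x = p.x + r.x := rfl
@[simp] theorem mul_y (p r : Heis F) : (p * r).y = p.y + r.y := rfl
@[simp] theorem mul_t (p r : Heis F) :
    (p * r).t = p.t + r.t + (p.x * r.y - p.y * r.x) := rfl
@[simp] theorem one_x : (1 : Heis F).x = 0 := rfl
@[simp] theorem one_y : (1 : Heis F).y = 0 := rfl
@[simp] theorem one_t : (1 : Heis F).t = 0 := rfl
@[simp] theorem inv_x (p : Heis F) : (p⁻¹).x = -p.x := rfl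
@[simp] theorem inv_y (p : Heis F) : (p⁻¹).y = -p.y := rfl
@[simp] theorem inv_t (p : Heis F) : (p⁻¹).t = -p.t := rfl

instance : Group (Heis F) :=
  Group.ofLeftAxioms
    (fun p r s => by ext <;> simp <;> ring)
    (fun p => by ext <;> simp)
    (fun p => Heis.ext (by simp) (by simp) (by simp; ring))

/-- The horizontal line `{p · (s a, s b, 0) : s ∈ F}` through `p` in direction `[a : b]`
(a line only when `(a, b) ≠ (0, 0)`). -/
def line (p : Heis F) (a b : F) : Set (Heis F) :=
  Set.range fun s : F => p * ⟨s * a, s * b, 0⟩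

end Basic

section Directions

variable {F : Type*} [Field F]

theorem triple_ne_zero {a b : F} (h : (a, b) ≠ (0, 0)) (c : F) : (a, b, c) ≠ (0 : F × F × F) := by
  intro h0
  simp only [Prod.mk_eq_zero] at h0
  exact h (by rw [h0.1, h0.2.1])

variable (F) in
/-- The refined direction set `𝒟₁ = {[a : b : c] ∈ ℙ²(F) : (a, b) ≠ (0, 0)}`. -/
def RefinedDir : Type _ :=
  {ω : ℙ F (F × F × F) // ∃ (a b c : F) (h : (a, b) ≠ (0, 0)),
    ω = Projectivization.mk F (a, b, c) (triple_ne_zero h c)}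

/-- The point `[a : b : c]` of `𝒟₁`. -/
def RefinedDir.mk (a b c : F) (h : (a, b) ≠ (0, 0)) : RefinedDir F :=
  ⟨Projectivization.mk F (a, b, c) (triple_ne_zero h c), a, b, c, h, rfl⟩

instance [Finite F] : Finite (RefinedDir F) :=
  inferInstanceAs (Finite {ω : ℙ F (F × F × F) // ∃ (a b c : F) (h : (a, b) ≠ (0, 0)),
    ω = Projectivization.mk F (a, b, c) (triple_ne_zero h c)})

noncomputable instance [Fintype F] : Fintype (RefinedDir F) := Fintype.ofFinite _

/-- `IsLineWithDir L ω`: the set `L` is a horizontal line and `Dir(L) = ω`. Here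
`Dir(L) = [a : b : c(L)]`, with the `t`-slope `c(L) = x₀ b - y₀ a` computed at a point
`p = (x₀, y₀, t₀)` of `L`. -/
def IsLineWithDir (L : Set (Heis F)) (ω : RefinedDir F) : Prop :=
  ∃ (p : Heis F) (a b : F) (h : (a, b) ≠ (0, 0)),
    L = line p a b ∧ ω = RefinedDir.mk a b (p.x * b - p.y * a) h

/-- `Dir(L)` is well defined. -/
theorem IsLineWithDir.unique {L : Set (Heis F)} {ω ω' : RefinedDir F}
    (h : IsLineWithDir L ω) (h' : IsLineWithDir L ω') : ω = ω' := by
  obtain ⟨p, a, b, hab, rfl, rfl⟩ := h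
  obtain ⟨p', a', b', hab', hL, rfl⟩ := h'
  have h0 : p' * ⟨0 * a', 0 * b', 0⟩ ∈ line p a b := hL ▸ ⟨0, rfl⟩
  have h1 : p' * ⟨1 * a', 1 * b', 0⟩ ∈ line p a b := hL ▸ ⟨1, rfl⟩
  obtain ⟨s, hs⟩ := h0
  obtain ⟨r, hr⟩ := h1
  simp only [Heis.ext_iff, mul_x, mul_y, mul_t] at hs hr
  obtain ⟨hs1, hs2, -⟩ := hs
  obtain ⟨hr1, hr2, -⟩ := hr
  have ha : a' = (r - s) * a := by linear_combination hs1 - hr1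
  have hb : b' = (r - s) * b := by linear_combination hs2 - hr2
  have hx : p'.x = p.x + s * a := by linear_combination -hs1
  have hy : p'.y = p.y + s * b := by linear_combination -hs2
  refine Subtype.ext ?_
  refine ((Projectivization.mk_eq_mk_iff' F _ _ _ _).2 ⟨r - s, ?_⟩).symm
  simp only [Prod.smul_mk, smul_eq_mul, ha, hb, hx, hy, Prod.mk.injEq, true_and]
  ring

/-- Every refined direction is the direction of some horizontal line. -/
theorem exists_isLineWithDir (ω : RefinedDir F) : ∃ L, IsLineWithDir L ω := by
  obtain ⟨ω, a, b, c, h, rfl⟩ := ω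
  by_cases hb : b = 0
  · have ha : a ≠ 0 := fun ha => h (by rw [ha, hb])
    refine ⟨_, ⟨0, -c / a, 0⟩, a, b, h, rfl, ?_⟩
    have : (0 : F) * b - -c / a * a = c := by field_simp; ring
    simp only [this]; rfl
  · refine ⟨_, ⟨c / b, 0, 0⟩, a, b, h, rfl, ?_⟩
    have : c / b * b - 0 * a = c := by field_simp; ring
    simp only [this]; rfl

/-- A full-direction horizontal Heisenberg Kakeya set. -/
def IsFullKakeya (E : Set (Heis F)) : Prop :=
  ∀ ω : RefinedDir F, ∃ L, IsLineWithDir L ω ∧ L ⊆ E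

end Directions

section Maximal

variable {F : Type*} [Field F] [Fintype F]

open Classical in
/-- The refined-direction horizontal maximal operator: the maximum, over the (finitely many, and
at least one) horizontal lines `L` with `Dir(L) = ω`, of `∑_{p ∈ L} |f(p)|`. -/
noncomputable def maximalRd (f : Heis F → ℂ) (ω : RefinedDir F) : ℝ :=
  ⨆ L : {L : Set (Heis F) // IsLineWithDir L ω}, ∑ p with p ∈ L.1, ‖f p‖

end Maximal

/-- The exponents `α ≥ 0` for which `‖ℳ^{rd} f‖_{ℓ^v(𝒟₁)} ≤ C q^α ‖f‖_{ℓ^u(ℍ₁(𝔽_q))}` holds with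
one constant `C` for all finite fields `𝔽_q` and all `f : ℍ₁(𝔽_q) → ℂ`; the norms are the `ℓ^p`
norms of counting measure. (Up to isomorphism, `Type` contains all finite fields.) -/
def rdExponents (u v : ℝ≥0∞) : Set ℝ :=
  {α | 0 ≤ α ∧ ∃ C : ℝ, 0 < C ∧ ∀ (F : Type) [Field F] [Fintype F] (f : Heis F → ℂ),
    ‖WithLp.toLp v (maximalRd f)‖ ≤ C * (Fintype.card F : ℝ) ^ α * ‖WithLp.toLp u f‖}

/-- The exponent `A₁^{rd}(u, v)`. -/
noncomputable def Ard (u v : ℝ≥0∞) : ℝ := sInf (rdExponents u v)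

end Heis

/-!
The heart of the matter is the bound `|Ω| m² ≤ 9 q |E|` (`Heis.ncard_mul_sq_le`), which is the second
assertion and, with `m = q` and `|Ω| ≥ q²`, the third.

The horizontal lines are the affine part of the generalized quadrangle of isotropic lines of a
symplectic form on `𝔽_q⁴`: two points lie on a common line exactly when they are orthogonal, and two
distinct points have at most `q` common orthogonal points. A second moment computation therefore
shows that the number of points of `E` orthogonal to a point is close to `|E| / q` on average
(`Heis.sum_card_orth_le`), so that `E` has few collinear pairs. Feeding this into a second moment
computation over the `q³` lines with directions `[1 : b : c]` shows that `|E ∩ L|` deviates from its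
mean `|E| / q²` by `2 q |E|` in square sum (`Heis.sum_sq_slope_le`). Either the mean exceeds `m / 2`,
and `E` is large for that reason, or each rich line contributes at least `m² / 4` to this sum. The
remaining directions `[0 : 1 : c]` belong to lines in disjoint planes and are harmless.

For general exponents, put `a = 1 / u` and `b = 1 / v`. The estimate is claimed at the infimal
exponent `Ard u v` itself, which need not be admissible a priori, so `Ard u v` is bounded from below
by explicit examples: a point, a horizontal line, the `y`-axis and the whole group give
`Ard u v ≥ max (b, 1 - a, 2 b - a, 1 + 2 b - 3 a)`. Conversely `m |Ω| ^ b ≤ 18 q ^ A |E| ^ a` holds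
for every `A` at least this maximum: on the logarithmic scale it follows by linear interpolation
from `|E| ≥ m` and the bound above (`Heis.log_interpolation`, `Heis.mul_rpow_le_Ard`).
-/

namespace Heis

/-! ### Horizontal lines in coordinates -/

section Lines

variable {F : Type*} [Field F]

/-- The horizontal line with direction `[1 : b : c]` that passes through the fibre `x = 0` at
height `t`. -/
def slopeLine (b c t : F) : Set (Heis F) := {p | p.y = p.x * b - c ∧ p.t = t + p.x * c}

/-- The direction `[1 : b : c]`. -/
def slopeDir (b c : F) : RefinedDir F := RefinedDir.mk 1 b c (by simp)

/-- The direction `[0 : 1 : c]`, carried by lines in the plane `x = c`. -/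
def vertDir (c : F) : RefinedDir F := RefinedDir.mk 0 1 c (by simp)

theorem RefinedDir.mk_eq_mk_iff {a b c a' b' c' : F} (h : (a, b) ≠ (0, 0))
    (h' : (a', b') ≠ (0, 0)) :
    RefinedDir.mk a b c h = RefinedDir.mk a' b' c' h' ↔
      ∃ k : F, k * a' = a ∧ k * b' = b ∧ k * c' = c := by
  refine Subtype.ext_iff.trans ((Projectivization.mk_eq_mk_iff' F _ _ _ _).trans ?_)
  simp [Prod.ext_iff]

theorem slopeDir_injective : Function.Injective fun z : F × F => slopeDir z.1 z.2 := by
  rintro ⟨b, c⟩ ⟨b', c'⟩ h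
  obtain ⟨k, h1, h2, h3⟩ := (RefinedDir.mk_eq_mk_iff _ _).1 h
  obtain rfl : k = 1 := by simpa using h1
  simp_all

theorem slopeDir_or_vertDir (ω : RefinedDir F) :
    (∃ b c, ω = slopeDir b c) ∨ ∃ c, ω = vertDir c := by
  obtain ⟨ω, a, b, c, h, rfl⟩ := ω
  by_cases ha : a = 0
  · have hb : b ≠ 0 := fun hb => h (by rw [ha, hb])
    refine Or.inr ⟨c / b, (RefinedDir.mk_eq_mk_iff h _).2 ⟨b, ?_, ?_, ?_⟩⟩
    · simp [ha]
    · simp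
    · field_simp
  · refine Or.inl ⟨b / a, c / a, (RefinedDir.mk_eq_mk_iff h _).2 ⟨a, ?_, ?_, ?_⟩⟩
    · simp
    · field_simp
    · field_simp

theorem isLineWithDir_slopeLine (b c t : F) : IsLineWithDir (slopeLine b c t) (slopeDir b c) := by
  refine ⟨⟨0, -c, t⟩, 1, b, by simp, ?_, ?_⟩
  · ext p
    simp only [slopeLine, line, Set.mem_ofPred_eq, Set.mem_range, Heis.ext_iff, mul_x, mul_y, mul_t]
    constructor
    · rintro ⟨h1, h2⟩
      exact ⟨p.x, by ring, by rw [h1]; ring, by rw [h2]; ring⟩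
    · rintro ⟨s, h1, h2, h3⟩
      exact ⟨by rw [← h1, ← h2]; ring, by rw [← h1, ← h3]; ring⟩
  · simp [slopeDir]

theorem IsLineWithDir.exists_slopeLine {L : Set (Heis F)} {b c : F}
    (h : IsLineWithDir L (slopeDir b c)) : ∃ t, L = slopeLine b c t := by
  obtain ⟨p, a, b', hab, rfl, hω⟩ := h
  obtain ⟨k, h1, h2, h3⟩ := (RefinedDir.mk_eq_mk_iff _ _).1 hω
  have hk : k ≠ 0 := by rintro rfl; simp at h1
  have ha : a ≠ 0 := by rintro rfl; simp at h1
  subst h2 h3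
  refine ⟨p.t - p.x * (k * (p.x * b' - p.y * a)), ?_⟩
  ext r
  simp only [slopeLine, line, Set.mem_ofPred_eq, Set.mem_range, Heis.ext_iff, mul_x, mul_y, mul_t]
  constructor
  · rintro ⟨s, e1, e2, e3⟩
    rw [← e1, ← e2, ← e3]
    constructor
    · linear_combination (-p.y - s * b') * h1
    · linear_combination (-(s * (p.x * b' - p.y * a))) * h1
  · rintro ⟨e1, e2⟩
    refine ⟨k * (r.x - p.x), ?_, ?_, ?_⟩
    · linear_combination (r.x - p.x) * h1
    · rw [e1]; linear_combination -p.y * h1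
    · rw [e2]; ring

theorem IsLineWithDir.x_eq_of_vertDir {L : Set (Heis F)} {c : F}
    (h : IsLineWithDir L (vertDir c)) {r : Heis F} (hr : r ∈ L) : r.x = c := by
  obtain ⟨p, a, b, hab, rfl, hω⟩ := h
  obtain ⟨k, h1, h2, h3⟩ := (RefinedDir.mk_eq_mk_iff _ _).1 hω
  have hk : k ≠ 0 := by rintro rfl; simp at h2
  obtain rfl : a = 0 := by simpa [hk] using h1
  obtain ⟨s, rfl⟩ := hr
  simp only [mul_x]
  linear_combination h3 - p.x * h2

theorem ncard_line [Fintype F] {L : Set (Heis F)} {ω : RefinedDir F} (h : IsLineWithDir L ω) :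
    L.ncard = Fintype.card F := by
  obtain ⟨p, a, b, hab, rfl, -⟩ := h
  rw [line, ← Set.image_univ, Set.ncard_image_of_injective, Set.ncard_univ,
    Nat.card_eq_fintype_card]
  intro s r hsr
  simp only [Heis.ext_iff, mul_x, mul_y, mul_t, add_right_inj] at hsr
  by_contra hne
  refine hab (Prod.ext ?_ ?_)
  · exact (mul_eq_mul_right_iff.1 hsr.1).resolve_left hne
  · exact (mul_eq_mul_right_iff.1 hsr.2.1).resolve_left hne

end Lines

/-! ### Counting incidences -/

section Counting

variable {F : Type*} [Field F] [Fintype F]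

omit [Field F] in
theorem card_heis : Fintype.card (Heis F) = Fintype.card F ^ 3 := by
  rw [Fintype.card_congr equivProd, Fintype.card_prod, Fintype.card_prod]
  ring

open Classical in
/-- The number of directions is in fact `q² + q`. -/
theorem card_refinedDir_le : Fintype.card (RefinedDir F) ≤ 2 * Fintype.card F ^ 2 := by
  have hsub : (Finset.univ : Finset (RefinedDir F)) ⊆
      (Finset.univ.image fun z : F × F => slopeDir z.1 z.2) ∪ Finset.univ.image vertDir := by
    intro ω _
    simp only [Finset.mem_union, Finset.mem_image, Finset.mem_univ, true_and, Prod.exists]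
    rcases slopeDir_or_vertDir ω with ⟨b, c, rfl⟩ | ⟨c, rfl⟩
    · exact Or.inl ⟨b, c, rfl⟩
    · exact Or.inr ⟨c, rfl⟩
  have h1 := (Finset.card_le_card hsub).trans (Finset.card_union_le _ _)
  have h2 := Finset.card_image_le (s := Finset.univ) (f := fun z : F × F => slopeDir z.1 z.2)
  have h3 := Finset.card_image_le (s := Finset.univ) (f := (vertDir : F → RefinedDir F))
  simp only [Finset.card_univ, Fintype.card_prod] at h1 h2 h3
  have hq : 1 ≤ Fintype.card F := Fintype.card_pos
  nlinarith

open Classical in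
/-- Variance identity for an incidence relation `R` in which every point lies on exactly `k`
blocks: the squared deviation of `ℓ ↦ |E ∩ ℓ|` from its mean `μ` is governed by the number of blocks
through pairs of points of `E`. -/
theorem sum_sq_sub_mean {P Λ : Type*} [Fintype Λ] (R : P → Λ → Prop) (E : Finset P)
    (k : ℕ) (hk : ∀ p, (Finset.univ.filter (R p)).card = k) (μ : ℝ)
    (hμ : μ * Fintype.card Λ = k * E.card) :
    ∑ ℓ, (((E.filter (R · ℓ)).card : ℝ) - μ) ^ 2 =
      ∑ p ∈ E, ∑ p' ∈ E, ((Finset.univ.filter fun ℓ => R p ℓ ∧ R p' ℓ).card : ℝ)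
        - μ * (k * E.card) := by
  have h1 : ∑ ℓ, ((E.filter (R · ℓ)).card : ℝ) = k * E.card := by
    simp only [Finset.card_filter, Nat.cast_sum]
    rw [Finset.sum_comm]
    simp only [← Nat.cast_sum, ← Finset.card_filter, hk]
    simp [mul_comm]
  have h2 : ∑ ℓ, ((E.filter (R · ℓ)).card : ℝ) ^ 2 =
      ∑ p ∈ E, ∑ p' ∈ E, ((Finset.univ.filter fun ℓ => R p ℓ ∧ R p' ℓ).card : ℝ) := by
    simp only [Finset.card_filter, Nat.cast_sum, sq, Finset.sum_mul_sum]
    rw [Finset.sum_comm]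
    refine Finset.sum_congr rfl fun p _ => ?_
    rw [Finset.sum_comm]
    refine Finset.sum_congr rfl fun p' _ => Finset.sum_congr rfl fun ℓ _ => ?_
    by_cases hp : R p ℓ <;> by_cases hp' : R p' ℓ <;> simp [hp, hp']
  simp only [sub_sq, Finset.sum_add_distrib, Finset.sum_sub_distrib, h2, Finset.sum_const,
    Finset.card_univ, nsmul_eq_mul]
  rw [← Finset.sum_mul, ← Finset.mul_sum, h1]
  linear_combination μ * hμ

/-- Two points are orthogonal when they lie on a common horizontal line, that is when `p⁻¹ p'` has
vanishing `t`-coordinate. In homogeneous coordinates this is orthogonality for a symplectic form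
on `F⁴`. -/
def Orth (p r : Heis F) : Prop := r.t - p.t = p.x * r.y - p.y * r.x

open Classical in
theorem card_orth (p : Heis F) : (Finset.univ.filter (Orth p)).card = Fintype.card F ^ 2 := by
  have : (Finset.univ : Finset (F × F)).card = Fintype.card F ^ 2 := by
    simp [Fintype.card_prod, sq]
  rw [← this]
  refine Finset.card_bij' (fun r _ => (r.x, r.y))
    (fun z _ => ⟨z.1, z.2, p.t + (p.x * z.2 - p.y * z.1)⟩) ?_ ?_ ?_ ?_
  · simp
  · intro z _
    simp [Orth]
  · intro r hr
    simp only [Finset.mem_filter, Finset.mem_univ, true_and, Orth] at hr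
    ext
    · rfl
    · rfl
    · simp only; linear_combination -hr
  · simp

open Classical in
theorem card_orth_inter_le {p p' : Heis F} (h : p ≠ p') :
    (Finset.univ.filter fun r => Orth p r ∧ Orth p' r).card ≤ Fintype.card F := by
  rw [← Finset.card_univ (α := F)]
  by_cases hx : p.x = p'.x
  · by_cases hy : p.y = p'.y
    · refine Finset.card_le_card_of_injOn Heis.x (by simp) fun r hr => (h ?_).elim
      replace hr := (Finset.mem_filter.1 (Finset.mem_coe.1 hr)).2
      simp only [Orth] at hr
      refine Heis.ext hx hy ?_
      have h1 := hr.1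
      rw [hx, hy] at h1
      linear_combination hr.2 - h1
    · refine Finset.card_le_card_of_injOn Heis.y (by simp) fun r hr s hs hrs => ?_
      replace hr := (Finset.mem_filter.1 (Finset.mem_coe.1 hr)).2
      replace hs := (Finset.mem_filter.1 (Finset.mem_coe.1 hs)).2
      simp only [Orth] at hr hs
      have h1 : (p.y - p'.y) * (r.x - s.x) = 0 := by
        linear_combination hr.1 - hr.2 - hs.1 + hs.2 + (p.x - p'.x) * hrs
      have h2 : r.x = s.x := by
        simpa [sub_ne_zero.2 hy, sub_eq_zero] using h1
      refine Heis.ext h2 hrs ?_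
      linear_combination hr.1 - hs.1 + p.x * hrs - p.y * h2
  · refine Finset.card_le_card_of_injOn Heis.x (by simp) fun r hr s hs hrs => ?_
    replace hr := (Finset.mem_filter.1 (Finset.mem_coe.1 hr)).2
    replace hs := (Finset.mem_filter.1 (Finset.mem_coe.1 hs)).2
    simp only [Orth] at hr hs
    have h1 : (p.x - p'.x) * (r.y - s.y) = 0 := by
      linear_combination -hr.1 + hr.2 + hs.1 - hs.2 + (p.y - p'.y) * hrs
    have h2 : r.y = s.y := by
      simpa [sub_ne_zero.2 hx, sub_eq_zero] using h1
    refine Heis.ext hrs h2 ?_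
    linear_combination hr.1 - hs.1 + p.x * h2 - p.y * hrs

open Classical in
/-- The number of orthogonal pairs in `E` exceeds the expected `|E|² / q` by at most `q |E|`. -/
theorem sum_card_orth_le (E : Finset (Heis F)) :
    ∑ p ∈ E, ((E.filter (Orth · p)).card : ℝ) ≤
      (E.card : ℝ) ^ 2 / Fintype.card F + Fintype.card F * E.card := by
  set q : ℝ := (Fintype.card F : ℝ) with hq
  set e : ℝ := (E.card : ℝ) with he
  have hq0 : 0 < q := by rw [hq]; exact_mod_cast Fintype.card_pos
  have he0 : 0 ≤ e := by positivity
  have hvar := sum_sq_sub_mean Orth E (Fintype.card F ^ 2) card_orth (e / q)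
    (by rw [card_heis]; push_cast; rw [← hq]; field_simp; simp [he])
  have hpairs : ∑ p ∈ E, ∑ p' ∈ E,
      ((Finset.univ.filter fun r => Orth p r ∧ Orth p' r).card : ℝ) ≤ q ^ 2 * e + q * e ^ 2 := by
    calc _ ≤ ∑ p ∈ E, ∑ p' ∈ E, ((if p = p' then q ^ 2 else 0) + q) := by
          gcongr with p _ p' _
          split_ifs with h
          · subst h
            simp only [and_self, card_orth]
            push_cast
            linarith
          · rw [zero_add, hq]
            exact_mod_cast card_orth_inter_le h
      _ = q ^ 2 * e + q * e ^ 2 := by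
          simp only [Finset.sum_add_distrib, Finset.sum_const, Finset.sum_ite_eq, nsmul_eq_mul,
            Finset.sum_ite_mem, Finset.inter_self]
          rw [← he]
          ring
  have hvar' : ∑ r, (((E.filter (Orth · r)).card : ℝ) - e / q) ^ 2 ≤ q ^ 2 * e := by
    rw [hvar]
    push_cast
    rw [← hq, ← he]
    have : e / q * (q ^ 2 * e) = q * e ^ 2 := by field_simp
    linarith
  have hsub : ∑ p ∈ E, (((E.filter (Orth · p)).card : ℝ) - e / q) ^ 2 ≤ q ^ 2 * e :=
    (Finset.sum_le_univ_sum_of_nonneg fun _ => sq_nonneg _).trans hvar'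
  have hcs := Finset.sum_mul_sq_le_sq_mul_sq E (fun _ => (1 : ℝ))
    (fun p => ((E.filter (Orth · p)).card : ℝ) - e / q)
  simp only [one_mul, one_pow, Finset.sum_const, nsmul_eq_mul, mul_one] at hcs
  have hle : ∑ p ∈ E, (((E.filter (Orth · p)).card : ℝ) - e / q) ≤ q * e := by
    refine (le_abs_self _).trans (abs_le_of_sq_le_sq ?_ (by positivity))
    calc _ ≤ e * (q ^ 2 * e) := hcs.trans (by gcongr)
      _ = (q * e) ^ 2 := by ring
  rw [Finset.sum_sub_distrib, Finset.sum_const, nsmul_eq_mul, ← he] at hle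
  have : e * (e / q) = e ^ 2 / q := by ring
  linarith

/-- Incidence of a point with the line `slopeLine b c t`, for `ℓ = (b, c, t)`. -/
def OnSlope (p : Heis F) (ℓ : F × F × F) : Prop := p ∈ slopeLine ℓ.1 ℓ.2.1 ℓ.2.2

open Classical in
theorem card_onSlope (p : Heis F) :
    (Finset.univ.filter (OnSlope p)).card = Fintype.card F := by
  rw [← Finset.card_univ (α := F)]
  refine Finset.card_bij' (fun ℓ _ => ℓ.1)
    (fun b _ => (b, p.x * b - p.y, p.t - p.x * (p.x * b - p.y))) ?_ ?_ ?_ ?_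
  · simp
  · intro b _
    simp [OnSlope, slopeLine]
  · rintro ⟨b, c, t⟩ h
    simp only [Finset.mem_filter, Finset.mem_univ, true_and, OnSlope, slopeLine,
      Set.mem_ofPred_eq] at h
    obtain ⟨h1, h2⟩ := h
    simp only [Prod.mk.injEq, true_and]
    exact ⟨by rw [h1]; ring, by rw [h1, h2]; ring⟩
  · simp

open Classical in
theorem card_onSlope_inter_le {p p' : Heis F} (h : p ≠ p') :
    (Finset.univ.filter fun ℓ => OnSlope p ℓ ∧ OnSlope p' ℓ).card ≤ if Orth p' p then 1 else 0 := by
  split_ifs with ho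
  · refine Finset.card_le_one.2 ?_
    rintro ⟨b, c, t⟩ hℓ ⟨b', c', t'⟩ hℓ'
    replace hℓ := (Finset.mem_filter.1 hℓ).2
    replace hℓ' := (Finset.mem_filter.1 hℓ').2
    simp only [OnSlope, slopeLine, Set.mem_ofPred_eq] at hℓ hℓ'
    obtain ⟨⟨h1, h2⟩, h3, h4⟩ := hℓ
    obtain ⟨⟨h5, h6⟩, h7, h8⟩ := hℓ'
    have hx : p.x - p'.x ≠ 0 := by
      intro hx
      have hx' : p.x = p'.x := sub_eq_zero.1 hx
      exact h (Heis.ext hx' (by rw [h1, h3, hx']) (by rw [h2, h4, hx']))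
    have hb : b = b' := by
      refine mul_left_cancel₀ hx ?_
      linear_combination h5 - h1 - h7 + h3
    subst hb
    have hc : c = c' := by linear_combination h1 - h5
    subst hc
    have ht : t = t' := by linear_combination h6 - h2
    rw [ht]
  · rw [Nat.le_zero, Finset.card_eq_zero, Finset.filter_eq_empty_iff]
    rintro ⟨b, c, t⟩ -
    simp only [OnSlope, slopeLine, Set.mem_ofPred_eq]
    rintro ⟨⟨h1, h2⟩, h3, h4⟩
    refine ho ?_
    rw [Orth, h1, h2, h3, h4]
    ring

open Classical in
/-- The lines of slope type meet `E` in `|E| / q²` points on average, with variance `O(|E| / q²)`: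
the sum below is over `q³` lines. -/
theorem sum_sq_slope_le (E : Finset (Heis F)) :
    ∑ ℓ, (((E.filter (OnSlope · ℓ)).card : ℝ) - E.card / (Fintype.card F : ℝ) ^ 2) ^ 2 ≤
      2 * Fintype.card F * E.card := by
  have horth := sum_card_orth_le E
  set q : ℝ := (Fintype.card F : ℝ) with hq
  set e : ℝ := (E.card : ℝ) with he
  have hq0 : 0 < q := by rw [hq]; exact_mod_cast Fintype.card_pos
  rw [sum_sq_sub_mean OnSlope E (Fintype.card F) card_onSlope (e / q ^ 2)
    (by simp only [Fintype.card_prod]; push_cast; rw [← hq, ← he]; field_simp)]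
  have hpairs : ∑ p ∈ E, ∑ p' ∈ E,
      ((Finset.univ.filter fun ℓ => OnSlope p ℓ ∧ OnSlope p' ℓ).card : ℝ) ≤
      q * e + ∑ p ∈ E, ((E.filter (Orth · p)).card : ℝ) := by
    calc _ ≤ ∑ p ∈ E, ∑ p' ∈ E,
          ((if p = p' then q else 0) + if Orth p' p then 1 else 0) := by
          gcongr with p _ p' _
          split_ifs with h1 h2 h2
          · subst h1
            simp only [and_self, card_onSlope, ← hq]
            linarith
          · subst h1
            simp only [and_self, card_onSlope, ← hq]
            linarith
          · have := card_onSlope_inter_le h1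
            rw [if_pos h2] at this
            rw [zero_add]
            exact_mod_cast this
          · have := card_onSlope_inter_le h1
            rw [if_neg h2] at this
            rw [zero_add]
            exact_mod_cast this
      _ = _ := by
          simp only [Finset.sum_add_distrib, Finset.sum_const, Finset.sum_ite_eq, nsmul_eq_mul,
            Finset.sum_ite_mem, Finset.inter_self, Finset.card_filter, Nat.cast_sum,
            Nat.cast_ite, Nat.cast_one, Nat.cast_zero]
          rw [← he]
          ring
  rw [← hq, ← he]
  have : e / q ^ 2 * (q * e) = e ^ 2 / q := by field_simp
  linarith

end Counting

/-! ### The Furstenberg-type bound -/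

section Furstenberg

variable {F : Type*} [Field F] [Fintype F]

open Classical in
theorem card_slope_mul_sq_le (E : Finset (Heis F)) (T : Finset (F × F)) (m : ℕ)
    (hm : m ≤ Fintype.card F)
    (hT : ∀ z ∈ T, ∃ t, m ≤ (E.filter (OnSlope · (z.1, z.2, t))).card) :
    (T.card : ℝ) * (m : ℝ) ^ 2 ≤ 8 * Fintype.card F * E.card := by
  have hvar := sum_sq_slope_le E
  have hTq : (T.card : ℝ) ≤ (Fintype.card F : ℝ) ^ 2 := by
    have := Finset.card_le_univ T
    rw [Fintype.card_prod, ← sq] at this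
    exact_mod_cast this
  have hmq : (m : ℝ) ≤ Fintype.card F := by exact_mod_cast hm
  have hq0 : (0 : ℝ) < Fintype.card F := by exact_mod_cast Fintype.card_pos
  set q : ℝ := (Fintype.card F : ℝ)
  set e : ℝ := (E.card : ℝ)
  by_cases hcase : (m : ℝ) ≤ 2 * (e / q ^ 2)
  · -- `E` is so dense that its mean incidence with a line is comparable to `m`.
    have h1 : (m : ℝ) * q ^ 2 ≤ 2 * e := by
      have := mul_le_mul_of_nonneg_right hcase (sq_nonneg q)
      rwa [mul_assoc, div_mul_cancel₀ _ (by positivity)] at this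
    calc (T.card : ℝ) * (m : ℝ) ^ 2 ≤ q ^ 2 * (m * q) := by
          rw [sq (m : ℝ)]; gcongr
      _ = q * (m * q ^ 2) := by ring
      _ ≤ q * (2 * e) := by gcongr
      _ ≤ 8 * q * e := by nlinarith [mul_nonneg hq0.le (Nat.cast_nonneg (α := ℝ) E.card)]
  · push Not at hcase
    choose! t ht using hT
    have hinj : Set.InjOn (fun z : F × F => (z.1, z.2, t z)) T := by
      rintro ⟨b, c⟩ - ⟨b', c'⟩ - h
      simp only [Prod.mk.injEq] at h
      exact Prod.ext h.1 h.2.1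
    have h1 : (T.card : ℝ) * ((m : ℝ) / 2) ^ 2 ≤
        ∑ z ∈ T, (((E.filter (OnSlope · (z.1, z.2, t z))).card : ℝ) - e / q ^ 2) ^ 2 := by
      rw [← nsmul_eq_mul]
      refine Finset.card_nsmul_le_sum _ _ _ fun z hz => ?_
      have : (m : ℝ) ≤ (E.filter (OnSlope · (z.1, z.2, t z))).card := by exact_mod_cast ht z hz
      gcongr
      linarith
    rw [← Finset.sum_image (f := fun ℓ => (((E.filter (OnSlope · ℓ)).card : ℝ) - e / q ^ 2) ^ 2)
      hinj] at h1
    have h2 := h1.trans ((Finset.sum_le_univ_sum_of_nonneg fun _ => sq_nonneg _).trans hvar)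
    nlinarith

omit [Field F] in
open Classical in
/-- Lines with directions `[0 : 1 : c]` lie in the disjoint planes `x = c`. -/
theorem card_vert_mul_le (E : Finset (Heis F)) (T : Finset F) (m : ℕ)
    (hT : ∀ c ∈ T, m ≤ (E.filter (·.x = c)).card) : T.card * m ≤ E.card := by
  calc T.card * m ≤ ∑ c ∈ T, (E.filter (·.x = c)).card := Finset.card_nsmul_le_sum _ _ _ hT
    _ ≤ ∑ c, (E.filter (·.x = c)).card := Finset.sum_le_univ_sum_of_nonneg fun _ => Nat.zero_le _
    _ = E.card := (Finset.card_eq_sum_card_fiberwise (by simp)).symm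

open Classical in
theorem ncard_mul_sq_le (Ω : Set (RefinedDir F)) (E : Set (Heis F)) (m : ℕ)
    (hm : m ≤ Fintype.card F)
    (hΩ : ∀ ω ∈ Ω, ∃ L : Set (Heis F), IsLineWithDir L ω ∧ m ≤ (E ∩ L).ncard) :
    (Ω.ncard : ℝ) * (m : ℝ) ^ 2 ≤ 9 * Fintype.card F * E.ncard := by
  set E' : Finset (Heis F) := E.toFinset
  have hE : E.ncard = E'.card := Set.ncard_eq_toFinset_card' E
  set T₁ : Finset (F × F) := Finset.univ.filter fun z => slopeDir z.1 z.2 ∈ Ω with hT₁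
  set T₂ : Finset F := Finset.univ.filter fun c => vertDir c ∈ Ω with hT₂
  have h1 := card_slope_mul_sq_le E' T₁ m hm fun z hz => by
    obtain ⟨L, hL, hmL⟩ := hΩ _ (Finset.mem_filter.1 hz).2
    obtain ⟨t, rfl⟩ := hL.exists_slopeLine
    refine ⟨t, hmL.trans (le_of_eq ?_)⟩
    rw [Set.ncard_eq_toFinset_card']
    congr 1
    ext p
    rw [Set.mem_toFinset, Finset.mem_filter, Set.mem_toFinset]
    rfl
  have h2 := card_vert_mul_le E' T₂ m fun c hc => by
    obtain ⟨L, hL, hmL⟩ := hΩ _ (Finset.mem_filter.1 hc).2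
    refine hmL.trans ?_
    rw [Set.ncard_eq_toFinset_card']
    refine Finset.card_le_card fun p hp => ?_
    simp only [Set.mem_toFinset, Set.mem_inter_iff] at hp
    simp only [E', Finset.mem_filter, Set.mem_toFinset]
    exact ⟨hp.1, hL.x_eq_of_vertDir hp.2⟩
  have h3 : Ω.ncard ≤ T₁.card + T₂.card := by
    have hsub : Ω.toFinset ⊆ (T₁.image fun z => slopeDir z.1 z.2) ∪ T₂.image vertDir := by
      intro ω hω
      rw [Set.mem_toFinset] at hω
      simp only [Finset.mem_union, Finset.mem_image, hT₁, hT₂, Finset.mem_filter, Finset.mem_univ,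
        true_and, Prod.exists]
      rcases slopeDir_or_vertDir ω with ⟨b, c, rfl⟩ | ⟨c, rfl⟩
      · exact Or.inl ⟨b, c, hω, rfl⟩
      · exact Or.inr ⟨c, hω, rfl⟩
    rw [Set.ncard_eq_toFinset_card']
    exact (Finset.card_le_card hsub).trans ((Finset.card_union_le _ _).trans
      (add_le_add Finset.card_image_le Finset.card_image_le))
  have h2' : (T₂.card : ℝ) * m ≤ E'.card := by exact_mod_cast h2
  have h3' : (Ω.ncard : ℝ) ≤ T₁.card + T₂.card := by exact_mod_cast h3
  have hmq : (m : ℝ) ≤ Fintype.card F := by exact_mod_cast hm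
  rw [hE]
  calc (Ω.ncard : ℝ) * (m : ℝ) ^ 2 ≤ (T₁.card + T₂.card) * (m : ℝ) ^ 2 := by gcongr
    _ = T₁.card * (m : ℝ) ^ 2 + m * (T₂.card * m) := by ring
    _ ≤ 8 * Fintype.card F * E'.card + Fintype.card F * E'.card := by gcongr
    _ = _ := by ring

end Furstenberg

/-! ### Norms of indicator functions -/

section Norms

variable {ι : Type*} [Fintype ι]

theorem norm_indicator_le (u : ℝ≥0∞) (hu : 1 ≤ u) (E : Set ι) :
    ‖WithLp.toLp u (E.indicator fun _ => (1 : ℂ))‖ ≤ (E.ncard : ℝ) ^ (u⁻¹).toReal := by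
  classical
  rcases eq_or_ne u ∞ with rfl | hu'
  · rw [PiLp.norm_eq_ciSup]
    simp only [ENNReal.inv_top, ENNReal.toReal_zero, Real.rpow_zero]
    refine Real.iSup_le (fun i => ?_) zero_le_one
    by_cases hi : i ∈ E <;> simp [hi]
  · have hpos : 0 < u.toReal := ENNReal.toReal_pos (zero_lt_one.trans_le hu).ne' hu'
    rw [PiLp.norm_eq_sum hpos, ENNReal.toReal_inv, one_div]
    refine le_of_eq (congrArg (· ^ _) ?_)
    rw [Set.ncard_eq_toFinset_card', Finset.card_eq_sum_ones, Nat.cast_sum,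
      ← Finset.sum_filter_add_sum_filter_not Finset.univ (· ∈ E)]
    rw [Finset.sum_eq_zero (s := Finset.univ.filter (· ∉ E)), add_zero]
    · refine Finset.sum_congr (by ext; simp) fun i hi => ?_
      rw [Set.mem_toFinset] at hi
      simp [hi]
    · intro i hi
      simp [(Finset.mem_filter.1 hi).2, hpos.ne']

theorem le_norm_of_le_on (v : ℝ≥0∞) (hv : 1 ≤ v) (g : ι → ℝ) (Ω : Set ι) (hΩ : Ω.Nonempty)
    (m : ℝ) (hm : 0 ≤ m) (h : ∀ i ∈ Ω, m ≤ g i) :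
    m * (Ω.ncard : ℝ) ^ (v⁻¹).toReal ≤ ‖WithLp.toLp v g‖ := by
  classical
  have : Fact (1 ≤ v) := ⟨hv⟩
  rcases eq_or_ne v ∞ with rfl | hv'
  · obtain ⟨i, hi⟩ := hΩ
    simp only [ENNReal.inv_top, ENNReal.toReal_zero, Real.rpow_zero, mul_one]
    exact (h i hi).trans ((le_abs_self _).trans (PiLp.norm_apply_le (WithLp.toLp ∞ g) i))
  · have hpos : 0 < v.toReal := ENNReal.toReal_pos (zero_lt_one.trans_le hv).ne' hv'
    rw [PiLp.norm_eq_sum hpos, ENNReal.toReal_inv, one_div]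
    calc m * (Ω.ncard : ℝ) ^ v.toReal⁻¹ = (Ω.ncard * m ^ v.toReal) ^ v.toReal⁻¹ := by
          rw [Real.mul_rpow (by positivity) (by positivity), Real.rpow_rpow_inv hm hpos.ne',
            mul_comm]
      _ ≤ _ := by
          refine Real.rpow_le_rpow (by positivity) ?_ (by positivity)
          rw [Set.ncard_eq_toFinset_card', ← nsmul_eq_mul]
          refine (Finset.card_nsmul_le_sum Ω.toFinset (fun i => ‖g i‖ ^ v.toReal) _
            fun i hi => ?_).trans (Finset.sum_le_univ_sum_of_nonneg fun _ => by positivity)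
          exact Real.rpow_le_rpow hm ((h i (Set.mem_toFinset.1 hi)).trans (le_abs_self _))
            hpos.le

theorem norm_le_card_mul (v : ℝ≥0∞) (hv : 1 ≤ v) (g : ι → ℝ) (B : ℝ)
    (h : ∀ i, |g i| ≤ B) : ‖WithLp.toLp v g‖ ≤ Fintype.card ι * B := by
  classical
  have : Fact (1 ≤ v) := ⟨hv⟩
  have hg : WithLp.toLp v g = ∑ i, PiLp.single v i (g i) := by
    simp only [PiLp.single, ← WithLp.toLp_sum, Finset.univ_sum_single]
  rw [hg]
  refine (norm_sum_le _ _).trans ?_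
  rw [← nsmul_eq_mul]
  refine Finset.sum_le_card_nsmul _ _ _ fun i _ => ?_
  rw [PiLp.norm_single]
  exact h i

end Norms

/-! ### Admissible exponents -/

section Exponents

open Classical in
theorem le_maximalRd {F : Type*} [Field F] [Fintype F] (f : Heis F → ℂ) {ω : RefinedDir F}
    {L : Set (Heis F)} (hL : IsLineWithDir L ω) :
    ∑ p with p ∈ L, ‖f p‖ ≤ maximalRd f ω :=
  le_ciSup (f := fun L : {L : Set (Heis F) // IsLineWithDir L ω} => ∑ p with p ∈ L.1, ‖f p‖)
    (Set.finite_range _).bddAbove ⟨L, hL⟩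

theorem ncard_inter_le_maximalRd {F : Type*} [Field F] [Fintype F] (E : Set (Heis F))
    {ω : RefinedDir F} {L : Set (Heis F)} (hL : IsLineWithDir L ω) :
    ((E ∩ L).ncard : ℝ) ≤ maximalRd (E.indicator fun _ => (1 : ℂ)) ω := by
  classical
  refine le_trans ?_ (le_maximalRd _ hL)
  rw [Set.ncard_eq_toFinset_card', Finset.card_eq_sum_ones, Nat.cast_sum]
  refine (Finset.sum_le_sum fun p hp => ?_).trans
    (Finset.sum_le_sum_of_subset_of_nonneg (s := (E ∩ L).toFinset) ?_ fun _ _ _ => norm_nonneg _)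
  · rw [Set.mem_toFinset] at hp
    simp [hp.1]
  · intro p hp
    rw [Set.mem_toFinset] at hp
    simpa using hp.2

/-- The crude bound `‖ℳ f‖_v ≤ |𝒟₁| |ℍ₁| ‖f‖_u`; without it the infimum defining `Ard u v` could
be that of the empty set. -/
theorem rdExponents_nonempty {u v : ℝ≥0∞} (hu : 1 ≤ u) (hv : 1 ≤ v) :
    (rdExponents u v).Nonempty := by
  classical
  refine ⟨5, by norm_num, 2, by norm_num, fun F _ _ f => ?_⟩
  have : Fact (1 ≤ u) := ⟨hu⟩
  have hB : ∀ ω, |maximalRd f ω| ≤ (Fintype.card F : ℝ) ^ 3 * ‖WithLp.toLp u f‖ := by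
    intro ω
    have h0 : 0 ≤ maximalRd f ω :=
      Real.iSup_nonneg fun _ => Finset.sum_nonneg fun _ _ => norm_nonneg _
    rw [abs_of_nonneg h0]
    refine Real.iSup_le (fun L => ?_) (by positivity)
    calc ∑ p with p ∈ L.1, ‖f p‖ ≤ ∑ p, ‖f p‖ :=
          Finset.sum_le_univ_sum_of_nonneg fun _ => norm_nonneg _
      _ ≤ Fintype.card (Heis F) • ‖WithLp.toLp u f‖ :=
          Finset.sum_le_card_nsmul _ _ _ fun p _ => PiLp.norm_apply_le (WithLp.toLp u f) p
      _ = _ := by rw [card_heis, nsmul_eq_mul]; push_cast; rfl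
  have hD : (Fintype.card (RefinedDir F) : ℝ) ≤ 2 * (Fintype.card F : ℝ) ^ 2 := by
    exact_mod_cast card_refinedDir_le
  calc ‖WithLp.toLp v (maximalRd f)‖
      ≤ Fintype.card (RefinedDir F) * ((Fintype.card F : ℝ) ^ 3 * ‖WithLp.toLp u f‖) :=
        norm_le_card_mul v hv _ _ hB
    _ ≤ 2 * (Fintype.card F : ℝ) ^ 2 * ((Fintype.card F : ℝ) ^ 3 * ‖WithLp.toLp u f‖) := by
        gcongr
    _ = 2 * (Fintype.card F : ℝ) ^ (5 : ℝ) * ‖WithLp.toLp u f‖ := by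
        rw [show (5 : ℝ) = ((5 : ℕ) : ℝ) by norm_num, Real.rpow_natCast]
        ring

theorem le_of_forall_prime_rpow_le {e α C : ℝ}
    (h : ∀ p : ℕ, p.Prime → (p : ℝ) ^ e ≤ C * (p : ℝ) ^ α) : e ≤ α := by
  by_contra! hlt
  have htend := (tendsto_rpow_atTop (sub_pos.2 hlt)).comp tendsto_natCast_atTop_atTop
  obtain ⟨n, hn⟩ := (htend.eventually_gt_atTop C).exists_forall_of_atTop
  obtain ⟨p, hnp, hp⟩ := Nat.exists_infinite_primes n
  have hp0 : (0 : ℝ) < p := by exact_mod_cast hp.pos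
  have h1 : C < (p : ℝ) ^ (e - α) := hn p hnp
  rw [Real.rpow_sub hp0, lt_div_iff₀ (by positivity)] at h1
  exact (h p hp).not_gt h1

/-- Testing the maximal inequality on the indicator function of a set of `q ^ k` points which, for
`q ^ j` directions, contains `q ^ i` points of some line. -/
theorem le_Ard_of_example {u v : ℝ≥0∞} (hu : 1 ≤ u) (hv : 1 ≤ v) (i j k : ℕ)
    (h : ∀ (F : Type) [Field F] [Fintype F], ∃ (E : Set (Heis F)) (Ω : Set (RefinedDir F)),
      E.ncard = Fintype.card F ^ k ∧ Ω.ncard = Fintype.card F ^ j ∧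
      ∀ ω ∈ Ω, ∃ L, IsLineWithDir L ω ∧ Fintype.card F ^ i ≤ (E ∩ L).ncard) :
    i + j * (v⁻¹).toReal - k * (u⁻¹).toReal ≤ Ard u v := by
  refine le_csInf (rdExponents_nonempty hu hv) ?_
  rintro α ⟨-, C, hC, hα⟩
  refine le_of_forall_prime_rpow_le (C := C) fun p hp => ?_
  have : Fact p.Prime := ⟨hp⟩
  obtain ⟨E, Ω, hE, hΩ, hL⟩ := h (ZMod p)
  have hp0 : (0 : ℝ) < p := by exact_mod_cast hp.pos
  rw [ZMod.card] at hE hΩ hL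
  have hne : Ω.Nonempty := by
    apply Set.nonempty_of_ncard_ne_zero
    rw [hΩ]
    exact pow_ne_zero _ hp.ne_zero
  have h1 := le_norm_of_le_on v hv (maximalRd (E.indicator fun _ => (1 : ℂ))) Ω hne
    ((p : ℝ) ^ i) (by positivity) fun ω hω => by
      obtain ⟨L, hL1, hL2⟩ := hL ω hω
      exact le_trans (by exact_mod_cast hL2) (ncard_inter_le_maximalRd E hL1)
  have h2 := h1.trans ((hα (ZMod p) (E.indicator fun _ => (1 : ℂ))).trans
    (mul_le_mul_of_nonneg_left (norm_indicator_le u hu E) (by positivity)))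
  rw [hE, hΩ, ZMod.card] at h2
  push_cast at h2
  simp only [← Real.rpow_natCast] at h2
  rw [← Real.rpow_mul hp0.le, ← Real.rpow_mul hp0.le, ← Real.rpow_add hp0] at h2
  rw [Real.rpow_sub hp0, div_le_iff₀ (by positivity)]
  exact h2

theorem ncard_range_slopeDir {F : Type*} [Field F] [Fintype F] :
    (Set.range fun z : F × F => slopeDir z.1 z.2).ncard = Fintype.card F ^ 2 := by
  rw [← Set.image_univ, Set.ncard_image_of_injective _ slopeDir_injective, Set.ncard_univ,
    Nat.card_eq_fintype_card, Fintype.card_prod, sq]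

theorem one_le_ncard {α : Type*} [Finite α] {s : Set α} {a : α} (h : a ∈ s) : 1 ≤ s.ncard :=
  (Set.ncard_pos (Set.toFinite s)).2 ⟨a, h⟩

variable {u v : ℝ≥0∞}

/-- A single point. -/
theorem inv_le_Ard (hu : 1 ≤ u) (hv : 1 ≤ v) : (v⁻¹).toReal ≤ Ard u v := by
  have := le_Ard_of_example hu hv 0 1 0 fun F _ _ => by
    refine ⟨{1}, Set.range fun b => slopeDir b 0, by simp, ?_, ?_⟩
    · have hinj : Function.Injective fun b : F => slopeDir b (0 : F) := fun b b' h =>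
        (Prod.ext_iff.1 (slopeDir_injective (a₁ := (b, 0)) (a₂ := (b', 0)) h)).1
      rw [← Set.image_univ, Set.ncard_image_of_injective _ hinj, Set.ncard_univ,
        Nat.card_eq_fintype_card, pow_one]
    · rintro _ ⟨b, rfl⟩
      exact ⟨_, isLineWithDir_slopeLine b 0 0,
        one_le_ncard (a := 1) ⟨rfl, by simp [slopeLine]⟩⟩
  simpa using this

/-- A horizontal line, tested in its own direction. -/
theorem one_sub_inv_le_Ard (hu : 1 ≤ u) (hv : 1 ≤ v) : 1 - (u⁻¹).toReal ≤ Ard u v := by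
  have := le_Ard_of_example hu hv 1 0 1 fun F _ _ => by
    have hL := isLineWithDir_slopeLine (0 : F) 0 0
    refine ⟨slopeLine 0 0 0, {slopeDir 0 0}, by rw [ncard_line hL, pow_one], by simp, ?_⟩
    rintro _ rfl
    exact ⟨_, hL, by rw [Set.inter_self, ncard_line hL, pow_one]⟩
  simpa using this

/-- The `y`-axis, which meets a line of every direction `[1 : b : c]`. -/
theorem two_mul_inv_sub_inv_le_Ard (hu : 1 ≤ u) (hv : 1 ≤ v) :
    2 * (v⁻¹).toReal - (u⁻¹).toReal ≤ Ard u v := by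
  have := le_Ard_of_example hu hv 0 2 1 fun F _ _ => by
    refine ⟨Set.range fun y => ⟨0, y, 0⟩, _, ?_, ncard_range_slopeDir, ?_⟩
    · rw [← Set.image_univ, Set.ncard_image_of_injective, Set.ncard_univ,
        Nat.card_eq_fintype_card, pow_one]
      intro y y' h
      exact (Heis.ext_iff.1 h).2.1
    · rintro _ ⟨⟨b, c⟩, rfl⟩
      exact ⟨_, isLineWithDir_slopeLine b c 0,
        one_le_ncard (a := ⟨0, -c, 0⟩) ⟨⟨-c, rfl⟩, by simp [slopeLine]⟩⟩
  simpa using this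

/-- The whole group. -/
theorem one_add_two_mul_inv_sub_le_Ard (hu : 1 ≤ u) (hv : 1 ≤ v) :
    1 + 2 * (v⁻¹).toReal - 3 * (u⁻¹).toReal ≤ Ard u v := by
  have := le_Ard_of_example hu hv 1 2 3 fun F _ _ => by
    refine ⟨Set.univ, _, ?_, ncard_range_slopeDir, ?_⟩
    · rw [Set.ncard_univ, Nat.card_eq_fintype_card, card_heis]
    · rintro _ ⟨⟨b, c⟩, rfl⟩
      have hL := isLineWithDir_slopeLine b c 0
      exact ⟨_, hL, by rw [Set.univ_inter, ncard_line hL, pow_one]⟩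
  simpa using this

end Exponents

/-! ### Interpolation on the logarithmic scale -/

/-- With `M`, `V`, `Q`, `S` the logarithms of `m`, `|Ω|`, `q`, `|E|`: the functional
`M + b V - a S` is piecewise linear in `(M, V)` once `S` is minimal, and the four bounds on `A` are
its values at the vertices `(0, 1)`, `(1, 0)`, `(0, 2)`, `(1, 2)` (in units of `Q`). -/
theorem log_interpolation {a b A M V Q S k l : ℝ} (ha : 0 ≤ a) (ha1 : a ≤ 1) (hb : 0 ≤ b)
    (hb1 : b ≤ 1) (hA1 : b ≤ A) (hA2 : 1 - a ≤ A) (hA3 : 2 * b - a ≤ A)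
    (hA4 : 1 + 2 * b - 3 * a ≤ A) (hM : 0 ≤ M) (hMQ : M ≤ Q) (hV : 0 ≤ V) (hl : 0 ≤ l)
    (hk : 0 ≤ k) (hVQ : V ≤ 2 * Q + l) (hS1 : M ≤ S) (hS2 : 2 * M + V - Q - k ≤ S) :
    M + b * V - a * S ≤ A * Q + (k + l) := by
  have hak : a * k ≤ k := mul_le_of_le_one_left hk ha1
  have hbl : b * l ≤ l := mul_le_of_le_one_left hl hb1
  have hal : 0 ≤ a * l := mul_nonneg ha hl
  have hA : 0 ≤ A := hb.trans hA1
  rcases le_total (M + V) Q with hc | hc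
  · have h1 : a * M ≤ a * S := by gcongr
    have h2 : (1 - a) * M ≤ A * M := by gcongr
    have h3 : b * V ≤ A * V := by gcongr
    have h4 : A * (M + V) ≤ A * Q := by gcongr
    linarith
  · have h1 : a * (2 * M + V - Q - k) ≤ a * S := by gcongr
    rcases le_total a b with hab | hab
    · have h2 : (b - a) * V ≤ (b - a) * (2 * Q + l) :=
        mul_le_mul_of_nonneg_left hVQ (sub_nonneg.2 hab)
      have h3 : (1 + 2 * b - 3 * a) * M ≤ A * M := by gcongr
      have h4 : (2 * b - a) * (Q - M) ≤ A * (Q - M) :=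
        mul_le_mul_of_nonneg_right hA3 (sub_nonneg.2 hMQ)
      linarith
    · have h2 : (a - b) * (Q - M) ≤ (a - b) * V :=
        mul_le_mul_of_nonneg_left (by linarith) (sub_nonneg.2 hab)
      have h3 : (1 - a) * M ≤ A * M := by gcongr
      have h4 : b * (Q - M) ≤ A * (Q - M) :=
        mul_le_mul_of_nonneg_right hA1 (sub_nonneg.2 hMQ)
      linarith

/-- The restricted form of the maximal inequality at the infimal exponent `Ard u v` itself. -/
theorem mul_rpow_le_Ard {F : Type*} [Field F] [Fintype F] {u v : ℝ≥0∞} (hu : 1 ≤ u) (hv : 1 ≤ v)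
    (Ω : Set (RefinedDir F)) (E : Set (Heis F)) (m : ℕ) (hm : 1 ≤ m) (hmq : m ≤ Fintype.card F)
    (hne : Ω.Nonempty)
    (hΩ : ∀ ω ∈ Ω, ∃ L : Set (Heis F), IsLineWithDir L ω ∧ m ≤ (E ∩ L).ncard) :
    (m : ℝ) * (Ω.ncard : ℝ) ^ (v⁻¹).toReal ≤
      18 * (Fintype.card F : ℝ) ^ Ard u v * (E.ncard : ℝ) ^ (u⁻¹).toReal := by
  have inv_le : ∀ {w : ℝ≥0∞}, 1 ≤ w → (w⁻¹).toReal ≤ 1 := fun hw =>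
    ENNReal.toReal_le_of_le_ofReal zero_le_one (by simpa using hw)
  have hmE : m ≤ E.ncard := by
    obtain ⟨ω, hω⟩ := hne
    obtain ⟨L, -, hL⟩ := hΩ ω hω
    exact hL.trans (Set.ncard_le_ncard Set.inter_subset_left E.toFinite)
  have hN : 1 ≤ Ω.ncard := one_le_ncard hne.some_mem
  have hNq : Ω.ncard ≤ 2 * Fintype.card F ^ 2 := by
    refine le_trans ?_ card_refinedDir_le
    rw [← Nat.card_eq_fintype_card, ← Set.ncard_univ]
    exact Set.ncard_le_ncard (Set.subset_univ _) Set.finite_univ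
  have hmain := ncard_mul_sq_le Ω E m hmq hΩ
  have hm' : (1 : ℝ) ≤ m := by exact_mod_cast hm
  have hN' : (1 : ℝ) ≤ Ω.ncard := by exact_mod_cast hN
  have hmq' : (m : ℝ) ≤ Fintype.card F := by exact_mod_cast hmq
  have hNq' : (Ω.ncard : ℝ) ≤ 2 * (Fintype.card F : ℝ) ^ 2 := by exact_mod_cast hNq
  have hmE' : (m : ℝ) ≤ E.ncard := by exact_mod_cast hmE
  generalize (m : ℝ) = x at *
  generalize (Ω.ncard : ℝ) = N at *
  generalize (Fintype.card F : ℝ) = q at *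
  generalize (E.ncard : ℝ) = e at *
  have hx0 : 0 < x := by linarith
  have hN0 : 0 < N := by linarith
  have hq0 : 0 < q := by linarith
  have he0 : 0 < e := by linarith
  have hlog := log_interpolation (M := Real.log x) (V := Real.log N) (Q := Real.log q)
    (S := Real.log e) (k := Real.log 9) (l := Real.log 2)
    ENNReal.toReal_nonneg (inv_le hu) ENNReal.toReal_nonneg (inv_le hv)
    (inv_le_Ard hu hv) (one_sub_inv_le_Ard hu hv) (two_mul_inv_sub_inv_le_Ard hu hv)
    (one_add_two_mul_inv_sub_le_Ard hu hv) (Real.log_nonneg hm') (Real.log_le_log hx0 hmq')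
    (Real.log_nonneg hN') (Real.log_nonneg (by norm_num)) (Real.log_nonneg (by norm_num))
    (by
      have := Real.log_le_log hN0 hNq'
      rw [Real.log_mul (by norm_num) (by positivity), Real.log_pow] at this
      push_cast at this
      linarith)
    (Real.log_le_log hx0 hmE')
    (by
      have := Real.log_le_log (by positivity) hmain
      rw [Real.log_mul hN0.ne' (by positivity), Real.log_pow,
        Real.log_mul (by positivity) he0.ne', Real.log_mul (by norm_num) hq0.ne'] at this
      push_cast at this
      linarith)
  rw [← Real.log_le_log_iff (by positivity) (by positivity),
    Real.log_mul hx0.ne' (by positivity), Real.log_mul (by positivity) (by positivity),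
    Real.log_mul (by norm_num) (by positivity), Real.log_rpow hN0, Real.log_rpow hq0,
    Real.log_rpow he0, show (18 : ℝ) = 9 * 2 by norm_num, Real.log_mul (by norm_num) (by norm_num)]
  linarith

end Heis

theorem theorem1p7 :
    -- the bound for general exponents
    (∀ u v : ℝ≥0∞, 1 ≤ u → 1 ≤ v → ∃ c : ℝ, 0 < c ∧
      ∀ (F : Type*) [Field F] [Fintype F] (Ω : Set (Heis.RefinedDir F)) (E : Set (Heis F)) (m : ℕ),
        1 ≤ m → m ≤ Fintype.card F →
        -- for `v = ∞` the factor `|Ω| ^ (1 / v)` is read as `1`, so `Ω` has to be non-empty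
        (v = ∞ → Ω.Nonempty) →
        (∀ ω ∈ Ω, ∃ L : Set (Heis F), Heis.IsLineWithDir L ω ∧ m ≤ (E ∩ L).ncard) →
        (u ≠ ∞ →
          c * ((m : ℝ) ^ u.toReal * (Ω.ncard : ℝ) ^ (u / v).toReal *
            (Fintype.card F : ℝ) ^ (-(u.toReal * Heis.Ard u v))) ≤ (E.ncard : ℝ)) ∧
        -- for `u = ∞` the bound is read after taking `u`-th roots
        (u = ∞ →
          c * ((m : ℝ) * (Ω.ncard : ℝ) ^ (1 / v).toReal *
            (Fintype.card F : ℝ) ^ (-Heis.Ard u v)) ≤ 1)) ∧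
    -- the case `u = v = 2`
    (∃ c : ℝ, 0 < c ∧
      ∀ (F : Type*) [Field F] [Fintype F] (Ω : Set (Heis.RefinedDir F)) (E : Set (Heis F)) (m : ℕ),
        1 ≤ m → m ≤ Fintype.card F →
        (∀ ω ∈ Ω, ∃ L : Set (Heis F), Heis.IsLineWithDir L ω ∧ m ≤ (E ∩ L).ncard) →
        c * ((m : ℝ) ^ 2 * (Ω.ncard : ℝ) / (Fintype.card F : ℝ)) ≤ (E.ncard : ℝ)) ∧
    -- full-direction horizontal Heisenberg Kakeya sets
    (∃ c : ℝ, 0 < c ∧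
      ∀ (F : Type*) [Field F] [Fintype F] (E : Set (Heis F)), Heis.IsFullKakeya E →
        c * (Fintype.card F : ℝ) ^ 3 ≤ (E.ncard : ℝ)) := by
  refine ⟨fun u v hu hv => ?_, ⟨1 / 9, by norm_num, ?_⟩, ⟨1 / 9, by norm_num, ?_⟩⟩
  · refine ⟨(18 : ℝ) ^ (-(u.toReal + 1)), by positivity, ?_⟩
    intro F _ _ Ω E m hm hmq hv' hΩ
    have hq0 : (0 : ℝ) < Fintype.card F := by exact_mod_cast Fintype.card_pos
    have hv0 : v ≠ 0 := (zero_lt_one.trans_le hv).ne'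
    rcases Ω.eq_empty_or_nonempty with rfl | hne
    · -- Here `v < ∞`, so the power of `|Ω| = 0` has a positive exponent and vanishes.
      have hvt : v ≠ ∞ := fun h => by simpa using hv' h
      have hvpos : 0 < v.toReal := ENNReal.toReal_pos hv0 hvt
      refine ⟨fun hut => ?_, fun _ => ?_⟩
      · have hupos : 0 < u.toReal := ENNReal.toReal_pos (zero_lt_one.trans_le hu).ne' hut
        have hne0 : (u / v).toReal ≠ 0 := by
          rw [ENNReal.toReal_div]
          positivity
        rw [Set.ncard_empty, Nat.cast_zero, Real.zero_rpow hne0]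
        simp
      · have hne0 : (1 / v).toReal ≠ 0 := by
          rw [ENNReal.toReal_div, ENNReal.toReal_one]
          positivity
        rw [Set.ncard_empty, Nat.cast_zero, Real.zero_rpow hne0]
        simp
    · have key := Heis.mul_rpow_le_Ard hu hv Ω E m hm hmq hne hΩ
      refine ⟨fun hut => ?_, fun hut => ?_⟩
      · have hupos : 0 < u.toReal := ENNReal.toReal_pos (zero_lt_one.trans_le hu).ne' hut
        have hpow := Real.rpow_le_rpow (by positivity) key hupos.le
        rw [Real.mul_rpow (by positivity) (by positivity),
          Real.mul_rpow (by positivity) (by positivity),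
          Real.mul_rpow (by positivity) (by positivity), ← Real.rpow_mul (by positivity),
          ← Real.rpow_mul (by positivity), ENNReal.toReal_inv u,
          Real.rpow_inv_rpow (by positivity) hupos.ne'] at hpow
        have huv : (u / v).toReal = (v⁻¹).toReal * u.toReal := by
          rw [div_eq_mul_inv, ENNReal.toReal_mul, mul_comm]
        have h18 : (18 : ℝ) ^ (-(u.toReal + 1)) ≤ (18 : ℝ) ^ (-u.toReal) :=
          Real.rpow_le_rpow_of_exponent_le (by norm_num) (by linarith)
        rw [huv]
        calc _ ≤ (18 : ℝ) ^ (-u.toReal) * ((18 : ℝ) ^ u.toReal *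
              (Fintype.card F : ℝ) ^ (Heis.Ard u v * u.toReal) * E.ncard *
              (Fintype.card F : ℝ) ^ (-(u.toReal * Heis.Ard u v))) := by gcongr
          _ = E.ncard := by
            rw [Real.rpow_neg (by norm_num), Real.rpow_neg hq0.le, mul_comm (Heis.Ard u v)]
            field_simp
      · subst hut
        simp only [ENNReal.inv_top, ENNReal.toReal_zero, Real.rpow_zero, mul_one] at key
        rw [one_div, ENNReal.toReal_top, zero_add, Real.rpow_neg_one, Real.rpow_neg hq0.le]
        have : (0 : ℝ) < (Fintype.card F : ℝ) ^ Heis.Ard ∞ v := by positivity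
        rw [← div_eq_mul_inv, ← div_eq_inv_mul, div_div, div_le_one (by positivity)]
        linarith
  · intro F _ _ Ω E m _ hmq hΩ
    have hq0 : (0 : ℝ) < Fintype.card F := by exact_mod_cast Fintype.card_pos
    have h := Heis.ncard_mul_sq_le Ω E m hmq hΩ
    rw [← mul_div_assoc, div_le_iff₀ hq0]
    linarith
  · intro F _ _ E hE
    have hq0 : (0 : ℝ) < Fintype.card F := by exact_mod_cast Fintype.card_pos
    have h := Heis.ncard_mul_sq_le (Set.range fun z : F × F => Heis.slopeDir z.1 z.2) E
      (Fintype.card F) le_rfl fun ω _ => by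
        obtain ⟨L, hL, hLE⟩ := hE ω
        exact ⟨L, hL, by rw [Set.inter_eq_right.2 hLE, Heis.ncard_line hL]⟩
    rw [Heis.ncard_range_slopeDir] at h
    push_cast at h
    have h' : (Fintype.card F : ℝ) ^ 3 ≤ 9 * E.ncard := by
      refine le_of_mul_le_mul_left ?_ hq0
      linarith
    linarith
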